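/- Let $K$ be a field of characteristic $0$ with a non-archimedean absolute value $|\cdot|$ whose residue field $k$ has characteristic $p>0$. The Gauss absolute value on $K(z)$ is $\left|\sum a_i z^i/\sum b_j z^j\right|_{\mathrm{Gauss}}=\max_i|a_i|/\max_j|b_j|$, and $|G|_{\mathrm{Gauss}}$ is the largest Gauss absolute value of an entry of a matrix $G$. Let $\Omega$ be a complete algebraically closed extension of $K$ whose (non-archimedean) absolute value extends that of $K$, containing an element $t$ which is transcendental over $K$ and such that $|\cdot|$ induces the Gauss absolute value on $K(t)$ (for instance, the completed algebraic closure of the completion of $K(t)$ for the Gauss absolute value). For a field $F$ and $G\in M_n(F(z))$ put $G_0=I_n$ and $G_{s+1}=G_sG+G_s'$, where $'$ is $d/dz$ applied entrywise. Let $G\in M_n(K(z))$ with $|G|_{\mathrm{Gauss}}\le 1$. Let $\overline G\in M_n(k(z))$ be its reduction: each entry is written $P/Q$, where $P,Q$ have coefficients in the valuation ring and $Q$ does not reduce to $0$, and $P$, $Q$ are reduced coefficientwise. Let $R\in[0,+\infty]$ be the generic radius of convergence of $y'=Gy$, that is, the radius of convergence of the matrix power series $$\mathcal U(z)=\sum_{s\ge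 0}\frac{G_s(t)}{s!}(z-t)^s$$ over $\Omega$ (the solution of $y'=Gy$ with $\mathcal U(t)=I_n$). Let $\pi\in\Omega$ satisfy $\pi^{p-1}=-p$. Then the system $y'=\overline Gy$ is nilpotent, i.e. the matrix $\overline G_p$ of index $p$ in the sequence attached to $\overline G$ is nilpotent, if and only if $R>|\pi|$. Moreover $|\pi|=|p|^{1/(p-1)}$, which equals $p^{-1/(p-1)}$ when the absolute value is normalized by $|p|=1/p$. -/

import Mathlib

open scoped Nat

universe u

namespace GenericRadius

open Polynomial

noncomputable section

/-! ### Derivation of rational functions and the matrices `G_s` -/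

/-- The usual derivative `d/dz` on `F(z)`, for a field `F` of any characteristic. -/
def ratDeriv {F : Type*} [Field F] (f : RatFunc F) : RatFunc F :=
  algebraMap F[X] (RatFunc F)
      (derivative f.num * f.denom - f.num * derivative f.denom) /
    algebraMap F[X] (RatFunc F) (f.denom ^ 2)

/-- The quotient rule holds for every way of writing a rational function as a fraction. -/
theorem ratDeriv_div {F : Type*} [Field F] (P Q : F[X]) (hQ : Q ≠ 0) :
    ratDeriv (algebraMap F[X] (RatFunc F) P / algebraMap F[X] (RatFunc F) Q) =
      algebraMap F[X] (RatFunc F) (derivative P * Q - P * derivative Q) /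
        algebraMap F[X] (RatFunc F) (Q ^ 2) := by
  set f : RatFunc F := algebraMap F[X] (RatFunc F) P / algebraMap F[X] (RatFunc F) Q with hf
  have hd : f.denom ≠ 0 := f.denom_ne_zero
  have hinj := RatFunc.algebraMap_injective F
  have hQ' : algebraMap F[X] (RatFunc F) Q ≠ 0 := RatFunc.algebraMap_ne_zero hQ
  have hd' : algebraMap F[X] (RatFunc F) f.denom ≠ 0 := RatFunc.algebraMap_ne_zero hd
  have h1 : f.num * Q = P * f.denom := by
    apply hinj
    rw [map_mul, map_mul, ← div_eq_div_iff hd' hQ', RatFunc.num_div_denom f]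
  have h2 : derivative f.num * Q + f.num * derivative Q =
      derivative P * f.denom + P * derivative f.denom := by
    simpa only [derivative_mul] using congrArg derivative h1
  unfold ratDeriv
  rw [div_eq_div_iff (RatFunc.algebraMap_ne_zero (pow_ne_zero 2 hd))
    (RatFunc.algebraMap_ne_zero (pow_ne_zero 2 hQ)), ← map_mul, ← map_mul]
  congr 1
  linear_combination (Q * f.denom) * h2 - (derivative Q * f.denom + Q * derivative f.denom) * h1

/-- The sequence `G_0 = 1`, `G_{s+1} = G_s G + G_s'` attached to the system `y' = G y`: every
solution satisfies `y^{(s)} = G_s y`. -/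
def iterMatrix {F : Type*} [Field F] {n : ℕ} (G : Matrix (Fin n) (Fin n) (RatFunc F)) :
    ℕ → Matrix (Fin n) (Fin n) (RatFunc F)
  | 0 => 1
  | s + 1 => iterMatrix G s * G + (iterMatrix G s).map ratDeriv

/-- In characteristic `p`, the system `y' = G y` is nilpotent if the matrix `G_p` is nilpotent. -/
def IsNilpotentSystem {F : Type*} [Field F] (p : ℕ) [CharP F p] {n : ℕ}
    (G : Matrix (Fin n) (Fin n) (RatFunc F)) : Prop :=
  IsNilpotent (iterMatrix G p)

/-! ### Gauss absolute value and reduction -/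

section Gauss

variable {K : Type*} [NormedField K]

/-- The Gauss absolute value on `K(z)`: the quotient of the largest absolute value of a coefficient
of the numerator by that of the denominator. -/
def ratGaussNorm (f : RatFunc K) : ℝ := f.num.supNorm / f.denom.supNorm

/-- The Gauss norm of a matrix: the supremum of the Gauss absolute values of its entries. -/
def matrixGaussNorm {n : ℕ} (G : Matrix (Fin n) (Fin n) (RatFunc K)) : ℝ :=
  ⨆ ij : Fin n × Fin n, ratGaussNorm (G ij.1 ij.2)

end Gauss

section Reduction

variable (K : Type*) [NormedField K] [IsUltrametricDist K]

/-- The valuation ring of `K`. -/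
abbrev valRing : ValuationSubring K := (NormedField.valuation (K := K)).valuationSubring

/-- The residue field of `K`. -/
abbrev residueField : Type _ := IsLocalRing.ResidueField (valRing K)

variable {K}

theorem supNorm_mul (P Q : K[X]) : (P * Q).supNorm = P.supNorm * Q.supNorm := by
  have hna : IsNonarchimedean (NormedField.toAbsoluteValue K) :=
    fun x y => IsUltrametricDist.norm_add_le_max x y
  exact gaussNorm_mul hna one_pos P Q

/-- The Gauss absolute value may be computed on every fraction that represents the function. -/
theorem ratGaussNorm_div (P Q : K[X]) (hQ : Q ≠ 0) :
    ratGaussNorm (algebraMap K[X] (RatFunc K) P / algebraMap K[X] (RatFunc K) Q) =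
      P.supNorm / Q.supNorm := by
  set f : RatFunc K := algebraMap K[X] (RatFunc K) P / algebraMap K[X] (RatFunc K) Q with hf
  have hd : f.denom ≠ 0 := f.denom_ne_zero
  have hQ' : algebraMap K[X] (RatFunc K) Q ≠ 0 := RatFunc.algebraMap_ne_zero hQ
  have hd' : algebraMap K[X] (RatFunc K) f.denom ≠ 0 := RatFunc.algebraMap_ne_zero hd
  have h1 : f.num * Q = P * f.denom := by
    apply RatFunc.algebraMap_injective K
    rw [map_mul, map_mul, ← div_eq_div_iff hd' hQ', RatFunc.num_div_denom f]
  have h2 := congrArg Polynomial.supNorm h1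
  rw [supNorm_mul, supNorm_mul] at h2
  unfold ratGaussNorm
  rw [div_eq_div_iff (mt (supNorm_eq_zero_iff _).mp hd) (mt (supNorm_eq_zero_iff _).mp hQ)]
  exact h2

/-- `P / Q`, where `P` and `Q` have coefficients in the valuation ring and `Q` is nonzero modulo the
maximal ideal, represents the rational function `f`. -/
def Represents (f : RatFunc K) (P Q : (valRing K)[X]) : Prop :=
  Q.map (IsLocalRing.residue (valRing K)) ≠ 0 ∧
    f = algebraMap K[X] (RatFunc K) (P.map (valRing K).subtype) /
      algebraMap K[X] (RatFunc K) (Q.map (valRing K).subtype)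

/-- The fraction `P / Q` reduced coefficient by coefficient. -/
def reducedFraction (P Q : (valRing K)[X]) : RatFunc (residueField K) :=
  algebraMap (residueField K)[X] (RatFunc (residueField K))
      (P.map (IsLocalRing.residue (valRing K))) /
    algebraMap (residueField K)[X] (RatFunc (residueField K))
      (Q.map (IsLocalRing.residue (valRing K)))

theorem Represents.reducedFraction_eq {f : RatFunc K} {P Q P' Q' : (valRing K)[X]}
    (h : Represents f P Q) (h' : Represents f P' Q') :
    reducedFraction P Q = reducedFraction P' Q' := by
  have hinj : Function.Injective (valRing K).subtype := Subtype.val_injective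
  have aux : ∀ {R : (valRing K)[X]}, R.map (IsLocalRing.residue (valRing K)) ≠ 0 →
      algebraMap K[X] (RatFunc K) (R.map (valRing K).subtype) ≠ 0 := by
    intro R hR
    apply RatFunc.algebraMap_ne_zero
    rw [Ne, Polynomial.map_eq_zero_iff hinj]
    rintro rfl
    exact hR (Polynomial.map_zero _)
  have h1 := h.2.symm.trans h'.2
  rw [div_eq_div_iff (aux h.1) (aux h'.1), ← map_mul, ← map_mul] at h1
  have h2 := RatFunc.algebraMap_injective K h1
  rw [← Polynomial.map_mul, ← Polynomial.map_mul] at h2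
  have h3 := congrArg (Polynomial.map (IsLocalRing.residue (valRing K)))
    (Polynomial.map_injective _ hinj h2)
  rw [Polynomial.map_mul, Polynomial.map_mul] at h3
  unfold reducedFraction
  rw [div_eq_div_iff (RatFunc.algebraMap_ne_zero h.1) (RatFunc.algebraMap_ne_zero h'.1),
    ← map_mul, ← map_mul, h3]

theorem exists_represents {f : RatFunc K} (hf : ratGaussNorm f ≤ 1) :
    ∃ P Q : (valRing K)[X], Represents f P Q := by
  have hd : f.denom ≠ 0 := f.denom_ne_zero
  obtain ⟨i, hi⟩ := f.denom.exists_eq_supNorm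
  have hpos : 0 < f.denom.supNorm := lt_of_le_of_ne f.denom.supNorm_nonneg
    (Ne.symm (mt (supNorm_eq_zero_iff _).mp hd))
  set c := f.denom.coeff i with hc
  have hc0 : c ≠ 0 := by
    intro h
    rw [h, norm_zero] at hi
    exact hpos.ne' hi
  have hnum : f.num.supNorm ≤ f.denom.supNorm := (div_le_one hpos).mp hf
  have key : ∀ R : K[X], R.supNorm ≤ ‖c‖ →
      ∃ S : (valRing K)[X], S.map (valRing K).subtype = C c⁻¹ * R := by
    intro R hR
    have : C c⁻¹ * R ∈ Polynomial.lifts (valRing K).subtype := by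
      rw [Polynomial.lifts_iff_coeff_lifts]
      intro k
      refine ⟨⟨(C c⁻¹ * R).coeff k, ?_⟩, rfl⟩
      rw [Valuation.mem_valuationSubring_iff, NormedField.valuation_apply, ← NNReal.coe_le_coe,
        coe_nnnorm, coeff_C_mul, norm_mul, norm_inv, NNReal.coe_one,
        inv_mul_le_one₀ (norm_pos_iff.mpr hc0)]
      exact (R.le_supNorm k).trans hR
    exact (Polynomial.mem_lifts _).mp this
  obtain ⟨P, hP⟩ := key f.num (hnum.trans hi.le)
  obtain ⟨Q, hQ⟩ := key f.denom hi.le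
  refine ⟨P, Q, ?_, ?_⟩
  · intro h0
    have h1 : Q.coeff i = 1 := by
      apply Subtype.val_injective
      have := congrArg (fun R : K[X] => R.coeff i) hQ
      simp only [coeff_map, coeff_C_mul, ← hc, inv_mul_cancel₀ hc0] at this
      exact this
    have h2 := congrArg (fun R => R.coeff i) h0
    simp only [coeff_map, h1, map_one, coeff_zero] at h2
    exact one_ne_zero h2
  · have hC : algebraMap K[X] (RatFunc K) (C c⁻¹) ≠ 0 :=
      RatFunc.algebraMap_ne_zero (by simpa using hc0)
    rw [hP, hQ, map_mul, map_mul, mul_div_mul_left _ _ hC, RatFunc.num_div_denom]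

open Classical in
/-- Reduction modulo the maximal ideal, from `{f ∈ K(z) : |f|_Gauss ≤ 1}` to `k(z)`, where `k` is the
residue field: write `f = P / Q` with `P`, `Q` integral and `Q` nonzero modulo the maximal ideal,
and reduce `P` and `Q` coefficient by coefficient (and the value is `0` if `|f|_Gauss > 1`). -/
def ratReduction (f : RatFunc K) : RatFunc (residueField K) :=
  if h : ∃ P Q : (valRing K)[X], Represents f P Q then
    reducedFraction h.choose h.choose_spec.choose
  else 0

/-- The reduction does not depend on the fraction chosen. -/
theorem ratReduction_eq {f : RatFunc K} {P Q : (valRing K)[X]} (h : Represents f P Q) :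
    ratReduction f = reducedFraction P Q := by
  have h' : ∃ P Q : (valRing K)[X], Represents f P Q := ⟨P, Q, h⟩
  rw [ratReduction, dif_pos h']
  exact h'.choose_spec.choose_spec.reducedFraction_eq h

/-- The reduced matrix, entry by entry. -/
def matrixReduction {n : ℕ} (G : Matrix (Fin n) (Fin n) (RatFunc K)) :
    Matrix (Fin n) (Fin n) (RatFunc (residueField K)) :=
  G.map ratReduction

end Reduction

/-! ### Generic point and generic radius of convergence -/

section Generic

variable {K : Type*} [NormedField K] {Ω : Type*} [NontriviallyNormedField Ω] [NormedAlgebra K Ω]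

/-- The value `f(t)` of a rational function `f ∈ K(z)` at a point `t ∈ Ω` that is not a pole of `f`
(no point transcendental over `K` is a pole). -/
def ratEval (t : Ω) (f : RatFunc K) : Ω := aeval t f.num / aeval t f.denom

/-- `t ∈ Ω` is a generic point over `K`: it is transcendental over `K` and the absolute value of `Ω`
induces on `K(t)` the Gauss absolute value. -/
def IsGenericPoint (K : Type*) [NormedField K] {Ω : Type*} [NontriviallyNormedField Ω]
    [NormedAlgebra K Ω] (t : Ω) : Prop :=
  Transcendental K t ∧
    ∀ f : RatFunc K, ‖ratEval t f‖ = ratGaussNorm f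

/-- The entries of the solution `U = ∑ (G_s(t) / s!) (z - t)^s` of `y' = G y` with `U(t) = 1`, as
power series in `X = z - t`. -/
def genericSolution {n : ℕ} (G : Matrix (Fin n) (Fin n) (RatFunc K)) (t : Ω) :
    Matrix (Fin n) (Fin n) (PowerSeries Ω) :=
  Matrix.of fun i j => PowerSeries.mk fun s =>
    ratEval t (iterMatrix G s i j) / (s ! : Ω)

/-- The radius of convergence of a power series over `Ω`. -/
def seriesRadius (f : PowerSeries Ω) : ENNReal :=
  (FormalMultilinearSeries.ofScalars Ω fun s => PowerSeries.coeff s f).radius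

/-- The generic radius of convergence of `y' = G y`: the radius of convergence of the matrix series
`U`, that is, the least radius of convergence of its entries. -/
def genericRadius {n : ℕ} (G : Matrix (Fin n) (Fin n) (RatFunc K)) (t : Ω) : ENNReal :=
  ⨅ i, ⨅ j, seriesRadius (genericSolution G t i j)

end Generic

/-! ### Existence of the field `Ω` -/

section Existence

variable (K : Type*) [NormedField K]

theorem ratGaussNorm_zero : ratGaussNorm (0 : RatFunc K) = 0 := by
  simp [ratGaussNorm]

theorem exists_frac (f : RatFunc K) : ∃ P Q : K[X], Q ≠ 0 ∧ f = algebraMap K[X] (RatFunc K) P / algebraMap K[X] (RatFunc K) Q :=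
  ⟨f.num, f.denom, f.denom_ne_zero, (f.num_div_denom).symm⟩

theorem ratGaussNorm_nonneg (f : RatFunc K) : 0 ≤ ratGaussNorm f := div_nonneg (supNorm_nonneg _) (supNorm_nonneg _)

theorem ratGaussNorm_eq_zero {f : RatFunc K} (h : ratGaussNorm f = 0) : f = 0 := by
  unfold ratGaussNorm at h
  rcases div_eq_zero_iff.mp h with h | h
  · exact RatFunc.num_eq_zero_iff.mp ((supNorm_eq_zero_iff _).mp h)
  · exact absurd ((supNorm_eq_zero_iff _).mp h) f.denom_ne_zero

variable [IsUltrametricDist K]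

theorem ratGaussNorm_mul (f g : RatFunc K) : ratGaussNorm (f * g) = ratGaussNorm f * ratGaussNorm g := by
  obtain ⟨P, Q, hQ, rfl⟩ := exists_frac K f
  obtain ⟨R, S, hS, rfl⟩ := exists_frac K g
  rw [div_mul_div_comm, ← map_mul, ← map_mul, ratGaussNorm_div _ _ (mul_ne_zero hQ hS),
    ratGaussNorm_div _ _ hQ, ratGaussNorm_div _ _ hS, supNorm_mul, supNorm_mul, div_mul_div_comm]

theorem supNorm_add (P Q : K[X]) : (P + Q).supNorm ≤ max P.supNorm Q.supNorm := by
  obtain ⟨i, hi⟩ := (P+Q).exists_eq_supNorm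
  rw [hi, coeff_add]
  exact (IsUltrametricDist.norm_add_le_max _ _).trans (max_le_max (P.le_supNorm i) (Q.le_supNorm i))

theorem ratGaussNorm_add (f g : RatFunc K) : ratGaussNorm (f + g) ≤ max (ratGaussNorm f) (ratGaussNorm g) := by
  obtain ⟨P, Q, hQ, rfl⟩ := exists_frac K f
  obtain ⟨R, S, hS, rfl⟩ := exists_frac K g
  have q0 : 0 < Q.supNorm := lt_of_le_of_ne Q.supNorm_nonneg (Ne.symm (mt (supNorm_eq_zero_iff _).mp hQ))
  have s0 : 0 < S.supNorm := lt_of_le_of_ne S.supNorm_nonneg (Ne.symm (mt (supNorm_eq_zero_iff _).mp hS))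
  rw [div_add_div _ _ (RatFunc.algebraMap_ne_zero hQ) (RatFunc.algebraMap_ne_zero hS), ← map_mul, ← map_mul, ← map_mul, ← map_add, ratGaussNorm_div _ _ (mul_ne_zero hQ hS),
    ratGaussNorm_div _ _ hQ, ratGaussNorm_div _ _ hS]
  rw [supNorm_mul, div_le_iff₀ (mul_pos q0 s0)]
  refine (supNorm_add K _ _).trans ?_
  rw [supNorm_mul, supNorm_mul]
  rw [max_mul_of_nonneg _ _ (mul_pos q0 s0).le]
  apply le_of_eq
  congr 1 <;> field_simp

theorem ratGaussNorm_neg (f : RatFunc K) : ratGaussNorm (-f) = ratGaussNorm f := by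
  have h1 : ratGaussNorm (-1 : RatFunc K) = 1 := by
    have := ratGaussNorm_div (K := K) (C (-1)) (C 1) (by simp)
    rw [supNorm_C, supNorm_C] at this
    simpa using this
  rw [neg_eq_neg_one_mul, ratGaussNorm_mul, h1, one_mul]

/-- `K(z)` with the Gauss absolute value. -/
abbrev gaussField : NormedField (RatFunc K) :=
  { (inferInstance : Field (RatFunc K)) with
    norm x := ratGaussNorm x
    dist x y := ratGaussNorm (x - y)
    dist_self x := by simp [ratGaussNorm_zero]
    dist_comm x y := by rw [← neg_sub, ratGaussNorm_neg]
    dist_triangle x y z := by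
      rw [← sub_add_sub_cancel x y z]
      exact (ratGaussNorm_add K _ _).trans (max_le_add_of_nonneg (ratGaussNorm_nonneg K _) (ratGaussNorm_nonneg K _))
    eq_of_dist_eq_zero hxy := sub_eq_zero.mp (ratGaussNorm_eq_zero K hxy)
    dist_eq x y := by rw [← ratGaussNorm_neg]; congr 1; ring
    norm_mul x y := ratGaussNorm_mul K x y
    edist_dist x y := by rw [ENNReal.ofReal_eq_coe_nnreal] }

end Existence

theorem exists_algClosed_of_complete (F : Type u) [NontriviallyNormedField F] [IsUltrametricDist F] [CompleteSpace F] [CharZero F] :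
  ∃ (Ω : Type u) (_ : NontriviallyNormedField Ω) (_ : NormedAlgebra F Ω),
    IsUltrametricDist Ω ∧ CompleteSpace Ω ∧ IsAlgClosed Ω := by
  let i1 : NontriviallyNormedField (AlgebraicClosure F) := spectralNorm.nontriviallyNormedField F _
  let i2 : NormedAlgebra F (AlgebraicClosure F) := spectralNorm.normedAlgebra F _
  have : IsUltrametricDist (AlgebraicClosure F) := IsUltrametricDist.of_normedAlgebra F
  let i3 : NontriviallyNormedField (UniformSpace.Completion (AlgebraicClosure F)) :=
    { (inferInstance : NormedField (UniformSpace.Completion (AlgebraicClosure F))) with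
    non_trivial := by
      obtain ⟨x, hx⟩ := NontriviallyNormedField.non_trivial (α := AlgebraicClosure F)
      exact ⟨(x : UniformSpace.Completion (AlgebraicClosure F)), by rw [UniformSpace.Completion.norm_coe]; exact hx⟩ }
  let i4 : NormedAlgebra F (UniformSpace.Completion (AlgebraicClosure F)) := inferInstance
  have : IsUltrametricDist (UniformSpace.Completion (AlgebraicClosure F)) := IsUltrametricDist.of_normedAlgebra F
  have : CharZero (UniformSpace.Completion (AlgebraicClosure F)) := (RingHom.charZero_iff (algebraMap F _).injective).mp inferInstance
  refine ⟨UniformSpace.Completion (AlgebraicClosure F), i3, i4, inferInstance, inferInstance, ?_⟩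
  exact IsAlgClosed.of_denseRange (K := AlgebraicClosure F) UniformSpace.Completion.denseRange_coe

theorem exists_algClosed (F : Type u) [NontriviallyNormedField F] [IsUltrametricDist F] [CharZero F] :
  ∃ (Ω : Type u) (_ : NontriviallyNormedField Ω) (_ : NormedAlgebra F Ω),
    IsUltrametricDist Ω ∧ CompleteSpace Ω ∧ IsAlgClosed Ω := by
  let i3 : NontriviallyNormedField (UniformSpace.Completion F) :=
    { (inferInstance : NormedField (UniformSpace.Completion F)) with
    non_trivial := by
      obtain ⟨x, hx⟩ := NontriviallyNormedField.non_trivial (α := F)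
      exact ⟨(x : UniformSpace.Completion F), by rw [UniformSpace.Completion.norm_coe]; exact hx⟩ }
  have : IsUltrametricDist (UniformSpace.Completion F) := IsUltrametricDist.of_normedAlgebra F
  have : CharZero (UniformSpace.Completion F) := (RingHom.charZero_iff (algebraMap F _).injective).mp inferInstance
  obtain ⟨Ω, i, j, a, b, c⟩ := exists_algClosed_of_complete (UniformSpace.Completion F)
  let alg : Algebra F Ω := ((algebraMap (UniformSpace.Completion F) Ω).comp (algebraMap F (UniformSpace.Completion F))).toAlgebra
  refine ⟨Ω, i, { alg with norm_smul_le := fun r x => ?_ }, a, b, c⟩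
  rw [Algebra.smul_def, norm_mul]
  apply le_of_eq
  congr 1
  show ‖algebraMap (UniformSpace.Completion F) Ω (algebraMap F (UniformSpace.Completion F) r)‖ = _
  rw [norm_algebraMap', norm_algebraMap']

/-- A complete algebraically closed extension of `K` containing a generic point exists: the completed
algebraic closure of the completion of `K(t)`, with the Gauss absolute value. -/
theorem exists_genericPoint (K : Type u) [NontriviallyNormedField K] [IsUltrametricDist K] [CharZero K] :
  ∃ (Ω : Type u) (_ : NontriviallyNormedField Ω) (_ : NormedAlgebra K Ω),
    IsUltrametricDist Ω ∧ CompleteSpace Ω ∧ IsAlgClosed Ω ∧ ∃ t : Ω, IsGenericPoint K t := by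
  have hC : ∀ x : K, ratGaussNorm (algebraMap K (RatFunc K) x) = ‖x‖ := by
    intro x
    have := ratGaussNorm_div (K := K) (C x) (C 1) (by simp)
    rw [supNorm_C, supNorm_C] at this
    simp only [map_one, div_one, norm_one] at this
    exact this
  let : NontriviallyNormedField (RatFunc K) := { gaussField K with
    non_trivial := by
      obtain ⟨x, hx⟩ := NontriviallyNormedField.non_trivial (α := K)
      exact ⟨algebraMap K _ x, by rw [← hC] at hx; exact hx⟩ }
  have : IsUltrametricDist (RatFunc K) := IsUltrametricDist.isUltrametricDist_of_forall_norm_add_le_max_norm (ratGaussNorm_add K)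
  have : CharZero (RatFunc K) := (RingHom.charZero_iff (algebraMap K _).injective).mp inferInstance
  obtain ⟨Ω, i, j, a, b, c⟩ := exists_algClosed (RatFunc K)
  let ψ : RatFunc K →+* Ω := algebraMap _ _
  have hψ : ∀ f, ‖ψ f‖ = ratGaussNorm f := fun f => norm_algebraMap' Ω f
  let alg : Algebra K Ω := (ψ.comp (algebraMap K (RatFunc K))).toAlgebra
  let nalg : NormedAlgebra K Ω := { alg with
    norm_smul_le := fun r x => by
      rw [Algebra.smul_def, norm_mul]
      apply le_of_eq
      congr 1
      exact (hψ _).trans (hC r) }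
  have hev : ∀ P : K[X], aeval (ψ RatFunc.X) P = ψ (algebraMap K[X] (RatFunc K) P) := by
    intro P
    have : (eval₂RingHom (algebraMap K Ω) (ψ RatFunc.X)) = ψ.comp (algebraMap K[X] (RatFunc K)) := by
      apply Polynomial.ringHom_ext
      · intro a
        simp; rfl
      · simp
    exact congrArg (fun h => h P) this
  refine ⟨Ω, i, nalg, a, b, c, ψ RatFunc.X, ?_, ?_⟩
  · rw [transcendental_iff]
    intro P hP
    rw [hev, map_eq_zero] at hP
    exact (map_eq_zero_iff _ (RatFunc.algebraMap_injective K)).mp hP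
  · intro f
    rw [← hψ, ratEval, hev, hev, ← map_div₀, RatFunc.num_div_denom]

end

end GenericRadius

/-! Let Δ(M) = MG + M', so that G_s = Δ^s(1). Since Δ(MN) = M'N + MΔ(N), Leibniz gives Δ^N(M) = ∑
C(N,i) M^(i) G_{N-i}. This one formula serves both in characteristic p and over K.

In characteristic p the inner binomials of Δ^p vanish and d^p/dz^p = 0 on rational functions, so
Δ^p(M) = M G_p and G_{pk} = G_p^k (`iterMatrix_mul_char`). As reduction commutes with forming G_s,
the reduced system is nilpotent exactly when |G_{pk}| < 1 in Gauss norm for some k.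

The radius enters because, t being generic, the coefficients have norm |G_s|/|s!|, while by
Legendre's formula |s!| ≥ |π|^s, with |(p^k)!| = |π|^(p^k-1). If R > |π|, boundedness of |G_s|
r^s/|s!| for some r > |π| forces |G_{p^k}| → 0, hence nilpotency.

Conversely, suppose |G_N| < 1 with p ∣ N and N > 0, and let θ < 1 bound both |p| and |G_N|. In the
formula for Δ^N(M) the term i = 0 is controlled by |G_N|. The others carry C(N,i)·i!, a multiple of
N, because |M^(i)| ≤ |i!||M| (`ratGaussNorm_iterate_le`). So Δ^N contracts by θ
(`ratGaussNorm_iterate_conn_contract`), the |G_s| decay geometrically, and R ≥ |π| θ^(-1/N) > |π|.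
-/

open scoped Nat

namespace GenericRadius

open Polynomial Filter Topology

noncomputable section

/-! ### Iterated Leibniz rule for a twisted derivation. -/

section Leibniz

/-- Induction with Pascal's rule; no commutativity is needed. Keeping `d` and `D` distinct covers
both plain differentiation (`d = D`) and the operator M ↦ MG + M'. -/
theorem iterate_leibniz {A : Type*} [Ring A] (d D : A →+ A)
    (h : ∀ a b, D (a * b) = d a * b + a * D b) (a b : A) (N : ℕ) :
    D^[N] (a * b) =
      ∑ ij ∈ Finset.HasAntidiagonal.antidiagonal N, N.choose ij.1 • (d^[ij.1] a * D^[ij.2] b) := by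
  induction N with
  | zero => simp
  | succ N ih =>
    rw [Finset.sum_antidiagonal_choose_succ_nsmul (fun i j => d^[i] a * D^[j] b),
      Function.iterate_succ_apply', ih, map_sum, ← Finset.sum_add_distrib]
    refine Finset.sum_congr rfl fun ij hij => ?_
    rw [map_nsmul, h, nsmul_add, ← Function.iterate_succ_apply' d, ← Function.iterate_succ_apply' D,
      add_comm, Nat.choose_symm_of_eq_add (Finset.HasAntidiagonal.mem_antidiagonal.mp hij).symm]

end Leibniz

/-! ### Rational derivatives and the operator M ↦ MG + M'. -/

section Derivation

variable {F : Type*} [Field F]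

theorem ratDeriv_add (f g : RatFunc F) : ratDeriv (f + g) = ratDeriv f + ratDeriv g := by
  obtain ⟨P, Q, hQ, rfl⟩ : ∃ P Q : F[X], Q ≠ 0 ∧ f = algebraMap F[X] (RatFunc F) P /
    algebraMap F[X] (RatFunc F) Q := ⟨f.num, f.denom, f.denom_ne_zero, f.num_div_denom.symm⟩
  obtain ⟨R, S, hS, rfl⟩ : ∃ P Q : F[X], Q ≠ 0 ∧ g = algebraMap F[X] (RatFunc F) P /
    algebraMap F[X] (RatFunc F) Q := ⟨g.num, g.denom, g.denom_ne_zero, g.num_div_denom.symm⟩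
  have hQ' : algebraMap F[X] (RatFunc F) Q ≠ 0 := RatFunc.algebraMap_ne_zero hQ
  have hS' : algebraMap F[X] (RatFunc F) S ≠ 0 := RatFunc.algebraMap_ne_zero hS
  rw [div_add_div _ _ hQ' hS', ← map_mul, ← map_mul, ← map_mul, ← map_add,
    ratDeriv_div _ _ hQ, ratDeriv_div _ _ hS, ratDeriv_div _ _ (mul_ne_zero hQ hS)]
  simp only [derivative_mul, map_add, map_sub, map_mul, map_pow]
  field_simp
  ring

theorem ratDeriv_mul (f g : RatFunc F) : ratDeriv (f * g) = ratDeriv f * g + f * ratDeriv g := by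
  obtain ⟨P, Q, hQ, rfl⟩ : ∃ P Q : F[X], Q ≠ 0 ∧ f = algebraMap F[X] (RatFunc F) P /
    algebraMap F[X] (RatFunc F) Q := ⟨f.num, f.denom, f.denom_ne_zero, f.num_div_denom.symm⟩
  obtain ⟨R, S, hS, rfl⟩ : ∃ P Q : F[X], Q ≠ 0 ∧ g = algebraMap F[X] (RatFunc F) P /
    algebraMap F[X] (RatFunc F) Q := ⟨g.num, g.denom, g.denom_ne_zero, g.num_div_denom.symm⟩
  have hQ' : algebraMap F[X] (RatFunc F) Q ≠ 0 := RatFunc.algebraMap_ne_zero hQ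
  have hS' : algebraMap F[X] (RatFunc F) S ≠ 0 := RatFunc.algebraMap_ne_zero hS
  rw [div_mul_div_comm, ← map_mul, ← map_mul,
    ratDeriv_div _ _ hQ, ratDeriv_div _ _ hS, ratDeriv_div _ _ (mul_ne_zero hQ hS)]
  simp only [derivative_mul, map_add, map_sub, map_mul, map_pow]
  field_simp
  ring

theorem ratDeriv_algebraMap (P : F[X]) :
    ratDeriv (algebraMap F[X] (RatFunc F) P) = algebraMap F[X] (RatFunc F) (derivative P) := by
  simpa using ratDeriv_div P 1 one_ne_zero

/-- `ratDeriv` as an additive map. -/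
def ratDerivHom : RatFunc F →+ RatFunc F := AddMonoidHom.mk' ratDeriv ratDeriv_add

theorem iterate_ratDerivHom_algebraMap (P : F[X]) (k : ℕ) :
    ratDerivHom^[k] (algebraMap F[X] (RatFunc F) P) =
      algebraMap F[X] (RatFunc F) (derivative^[k] P) := by
  induction k with
  | zero => rfl
  | succ k ih =>
    rw [Function.iterate_succ_apply', ih, Function.iterate_succ_apply']
    exact ratDeriv_algebraMap _

theorem iterate_ratDerivHom_mul (f g : RatFunc F) (N : ℕ) :
    ratDerivHom^[N] (f * g) = ∑ ij ∈ Finset.HasAntidiagonal.antidiagonal N,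
      N.choose ij.1 • (ratDerivHom^[ij.1] f * ratDerivHom^[ij.2] g) :=
  iterate_leibniz ratDerivHom ratDerivHom ratDeriv_mul f g N

variable {n : ℕ}

/-- Entrywise differentiation of matrices of rational functions. -/
def matDeriv (F : Type*) [Field F] (n : ℕ) :
    Matrix (Fin n) (Fin n) (RatFunc F) →+ Matrix (Fin n) (Fin n) (RatFunc F) :=
  ratDerivHom.mapMatrix

theorem matDeriv_apply (M : Matrix (Fin n) (Fin n) (RatFunc F)) (i j : Fin n) :
    matDeriv F n M i j = ratDeriv (M i j) := rfl

theorem matDeriv_mul (M N : Matrix (Fin n) (Fin n) (RatFunc F)) :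
    matDeriv F n (M * N) = matDeriv F n M * N + M * matDeriv F n N := by
  ext i j
  rw [Matrix.add_apply, Matrix.mul_apply, Matrix.mul_apply, matDeriv_apply, Matrix.mul_apply,
    ← Finset.sum_add_distrib]
  refine (map_sum ratDerivHom _ _).trans (Finset.sum_congr rfl fun k _ => ?_)
  exact ratDeriv_mul _ _

theorem iterate_matDeriv_apply (M : Matrix (Fin n) (Fin n) (RatFunc F)) (i j : Fin n) (k : ℕ) :
    (matDeriv F n)^[k] M i j = ratDerivHom^[k] (M i j) := by
  induction k with
  | zero => rfl
  | succ k ih => rw [Function.iterate_succ_apply', Function.iterate_succ_apply', ← ih]; rfl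

/-- The operator `M ↦ M G + M'` on matrices. -/
def conn (G : Matrix (Fin n) (Fin n) (RatFunc F)) :
    Matrix (Fin n) (Fin n) (RatFunc F) →+ Matrix (Fin n) (Fin n) (RatFunc F) :=
  AddMonoidHom.mulRight G + matDeriv F n

theorem conn_apply (G M : Matrix (Fin n) (Fin n) (RatFunc F)) :
    conn G M = M * G + matDeriv F n M := rfl

theorem conn_mul (G M N : Matrix (Fin n) (Fin n) (RatFunc F)) :
    conn G (M * N) = matDeriv F n M * N + M * conn G N := by
  rw [conn_apply, conn_apply, matDeriv_mul, mul_add, mul_assoc]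
  abel

theorem iterMatrix_add (G : Matrix (Fin n) (Fin n) (RatFunc F)) (m N : ℕ) :
    iterMatrix G (m + N) = (conn G)^[N] (iterMatrix G m) := by
  induction N with
  | zero => rfl
  | succ N ih => rw [Function.iterate_succ_apply', ← ih]; rfl

theorem iterMatrix_eq_iterate (G : Matrix (Fin n) (Fin n) (RatFunc F)) (N : ℕ) :
    iterMatrix G N = (conn G)^[N] 1 := by
  simpa [iterMatrix] using iterMatrix_add G 0 N

/-- Leibniz applied to M = M·1, because the iterates of the operator on 1 are the G_j. -/
theorem iterate_conn (G M : Matrix (Fin n) (Fin n) (RatFunc F)) (N : ℕ) :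
    (conn G)^[N] M = ∑ ij ∈ Finset.HasAntidiagonal.antidiagonal N,
      N.choose ij.1 • ((matDeriv F n)^[ij.1] M * iterMatrix G ij.2) := by
  simp only [iterMatrix_eq_iterate]
  rw [← iterate_leibniz _ _ (conn_mul G), mul_one]

end Derivation

/-! ### Characteristic p: powers of the p-curvature. -/

section CharP

variable {F : Type*} [Field F] (p : ℕ) [Fact p.Prime] [CharP F p]

theorem iterate_derivative_char (P : F[X]) : derivative^[p] P = 0 := by
  have : (p ! : F) = 0 := by
    rw [CharP.cast_eq_zero_iff F p]
    exact Nat.dvd_factorial (Fact.out (p := p.Prime)).pos le_rfl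
  rw [← factorial_smul_hasseDeriv, LinearMap.smul_apply, ← Nat.cast_smul_eq_nsmul F, this, zero_smul]

theorem choose_smul_eq_zero {A : Type*} [AddCommGroup A] [Module (RatFunc F) A] {i j : ℕ}
    (hij : i + j = p) (hi : i ≠ 0) (hj : j ≠ 0) (a : A) : p.choose i • a = 0 := by
  have : CharP (RatFunc F) p := charP_of_injective_algebraMap (algebraMap F (RatFunc F)).injective p
  have h : ((p.choose i : ℕ) : RatFunc F) = 0 := by
    rw [CharP.cast_eq_zero_iff (RatFunc F) p]
    exact (Fact.out (p := p.Prime)).dvd_choose_self hi (by omega)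
  rw [← Nat.cast_smul_eq_nsmul (RatFunc F), h, zero_smul]

/-- Differentiate f·denom = num p times. The inner binomials vanish, as do the p-th derivatives of
both polynomials, which leaves f^(p)·denom = 0. -/
theorem iterate_ratDerivHom_char (f : RatFunc F) : ratDerivHom^[p] f = 0 := by
  have hp := (Fact.out (p := p.Prime)).ne_zero
  have h := iterate_ratDerivHom_mul f (algebraMap F[X] (RatFunc F) f.denom) p
  have hd := RatFunc.algebraMap_ne_zero f.denom_ne_zero
  have hfd := div_mul_cancel₀ (algebraMap F[X] (RatFunc F) f.num) hd
  rw [RatFunc.num_div_denom] at hfd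
  rw [hfd, iterate_ratDerivHom_algebraMap, iterate_derivative_char, map_zero,
    Finset.sum_eq_single (p, 0)] at h
  · simpa [f.denom_ne_zero] using h
  · rintro ⟨i, j⟩ hij hne
    rw [Finset.HasAntidiagonal.mem_antidiagonal] at hij
    rcases eq_or_ne i 0 with rfl | hi
    · obtain rfl : j = p := by simpa using hij
      rw [iterate_ratDerivHom_algebraMap, iterate_derivative_char]
      simp
    · refine choose_smul_eq_zero (F := F) p hij hi ?_ _
      rintro rfl
      exact hne (by simpa using hij)
  · simp

/-- The p-th iterate of the operator is right multiplication by G_p: of the Leibniz sum only the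
term without derivatives on the left factor survives. -/
theorem iterMatrix_mul_char {n : ℕ} (G : Matrix (Fin n) (Fin n) (RatFunc F)) (k : ℕ) :
    iterMatrix G (p * k) = iterMatrix G p ^ k := by
  induction k with
  | zero => simp [iterMatrix]
  | succ k ih =>
    rw [mul_add_one, iterMatrix_add, iterate_conn, ih, pow_succ, Finset.sum_eq_single (0, p)]
    · simp
    · rintro ⟨i, j⟩ hij hne
      rw [Finset.HasAntidiagonal.mem_antidiagonal] at hij
      rcases eq_or_ne j 0 with rfl | hj
      · obtain rfl : i = p := by simpa using hij
        have : (matDeriv F n)^[i] (iterMatrix G i ^ k) = 0 := by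
          ext a b
          rw [iterate_matDeriv_apply, iterate_ratDerivHom_char]
          rfl
        rw [this, zero_mul, smul_zero]
      · refine choose_smul_eq_zero (F := F) p hij ?_ hj _
        rintro rfl
        exact hne (by simpa using hij)
    · simp

end CharP

/-! ### Gauss norm of iterated derivatives. -/

section GaussBound

variable {K : Type*} [NormedField K] [IsUltrametricDist K]

theorem ratGaussNorm_algebraMap (P : K[X]) :
    ratGaussNorm (algebraMap K[X] (RatFunc K) P) = P.supNorm := by
  have := ratGaussNorm_div P 1 one_ne_zero
  rwa [map_one, div_one, ← C_1, supNorm_C, norm_one, div_one] at this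

theorem ratGaussNorm_nsmul (m : ℕ) (f : RatFunc K) :
    ratGaussNorm (m • f) = ‖(m : K)‖ * ratGaussNorm f := by
  have := ratGaussNorm_algebraMap (C (m : K))
  rw [supNorm_C, map_natCast, map_natCast] at this
  rw [nsmul_eq_mul, ratGaussNorm_mul, this]

theorem ratGaussNorm_sum_le {ι : Type*} (s : Finset ι) (f : ι → RatFunc K) {c : ℝ} (hc : 0 ≤ c)
    (h : ∀ i ∈ s, ratGaussNorm (f i) ≤ c) : ratGaussNorm (∑ i ∈ s, f i) ≤ c := by
  classical
  induction s using Finset.induction_on with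
  | empty => simpa [ratGaussNorm_zero] using hc
  | insert a s ha ih =>
    rw [Finset.sum_insert ha]
    exact (ratGaussNorm_add K _ _).trans (max_le (h a (Finset.mem_insert_self a s))
      (ih fun i hi => h i (Finset.mem_insert_of_mem hi)))

/-- The k-th derivative multiplies each coefficient by k! times a binomial coefficient, an integer
of norm at most 1. -/
theorem supNorm_iterate_derivative_le (P : K[X]) (k : ℕ) :
    (derivative^[k] P).supNorm ≤ ‖(k ! : K)‖ * P.supNorm := by
  obtain ⟨i, hi⟩ := (derivative^[k] P).exists_eq_supNorm
  rw [hi, coeff_iterate_derivative, Nat.descFactorial_eq_factorial_mul_choose, nsmul_eq_mul,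
    Nat.cast_mul, norm_mul, norm_mul, mul_assoc]
  refine mul_le_mul_of_nonneg_left ?_ (norm_nonneg _)
  exact (mul_le_of_le_one_left (norm_nonneg _) (IsUltrametricDist.norm_natCast_le_one K _)).trans
    (P.le_supNorm _)

/-- The polynomial bound is carried over to f = num/denom by strong induction, through Leibniz for
f·denom = num. The factor |k!| is what later makes the contraction work. -/
theorem ratGaussNorm_iterate_le (f : RatFunc K) (k : ℕ) :
    ratGaussNorm (ratDerivHom^[k] f) ≤ ‖(k ! : K)‖ * ratGaussNorm f := by
  induction k using Nat.strong_induction_on with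
  | _ k ih =>
  set q := algebraMap K[X] (RatFunc K) f.denom with hq
  have hq0 : q ≠ 0 := RatFunc.algebraMap_ne_zero f.denom_ne_zero
  have hqpos : 0 < ratGaussNorm q := lt_of_le_of_ne (ratGaussNorm_nonneg K q)
    fun h => hq0 (ratGaussNorm_eq_zero K h.symm)
  have hfq : f * q = algebraMap K[X] (RatFunc K) f.num := by
    conv_lhs => rw [← RatFunc.num_div_denom f]
    exact div_mul_cancel₀ _ hq0
  have h := iterate_ratDerivHom_mul f q k
  have hmem : (k, 0) ∈ Finset.HasAntidiagonal.antidiagonal k := by simp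
  -- Solve for the term in which all k derivatives fall on f.
  rw [← Finset.add_sum_erase _ _ hmem, ← sub_eq_iff_eq_add] at h
  simp only [Nat.choose_self, one_smul, Function.iterate_zero, id] at h
  rw [← mul_le_mul_iff_left₀ hqpos, ← ratGaussNorm_mul, ← h, sub_eq_add_neg]
  refine (ratGaussNorm_add K _ _).trans (max_le ?_ ?_)
  · rw [hfq, iterate_ratDerivHom_algebraMap, ratGaussNorm_algebraMap, mul_assoc,
      ← ratGaussNorm_mul, hfq, ratGaussNorm_algebraMap]
    exact supNorm_iterate_derivative_le _ _
  · rw [ratGaussNorm_neg]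
    refine ratGaussNorm_sum_le _ _ (mul_nonneg (mul_nonneg (norm_nonneg _)
      (ratGaussNorm_nonneg K f)) hqpos.le) ?_
    rintro ⟨i, j⟩ hij
    rw [Finset.mem_erase, Finset.HasAntidiagonal.mem_antidiagonal] at hij
    obtain ⟨hne, hij⟩ := hij
    have hik : i < k := by
      have : j ≠ 0 := by
        rintro rfl
        exact hne (by simpa using hij)
      omega
    -- Splitting k! as C(k,i)·i!·j! matches the binomial weight with the bounds |i!| for f and |j!|
    -- for the denominator.
    rw [ratGaussNorm_nsmul, ratGaussNorm_mul, hq, iterate_ratDerivHom_algebraMap,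
      ratGaussNorm_algebraMap, ratGaussNorm_algebraMap, ← hij, Nat.choose_symm_add,
      ← Nat.add_choose_mul_factorial_mul_factorial, Nat.cast_mul, Nat.cast_mul, norm_mul, norm_mul]
    calc _ ≤ ‖((i + j).choose j : K)‖ * ((‖(i ! : K)‖ * ratGaussNorm f) *
            (‖(j ! : K)‖ * f.denom.supNorm)) := by
          gcongr
          · exact supNorm_nonneg _
          · exact mul_nonneg (norm_nonneg _) (ratGaussNorm_nonneg K f)
          · exact ih i hik
          · exact supNorm_iterate_derivative_le _ _
      _ = _ := by ring

end GaussBound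

/-! ### Reduction, and contraction for the Gauss norm. -/

section Red

variable {K : Type*} [NormedField K] [IsUltrametricDist K]

theorem mem_valRing_iff {x : K} : x ∈ valRing K ↔ ‖x‖ ≤ 1 := by
  rw [Valuation.mem_valuationSubring_iff, NormedField.valuation_apply, ← NNReal.coe_le_coe,
    coe_nnnorm, NNReal.coe_one]

theorem residue_eq_zero_iff (x : valRing K) :
    IsLocalRing.residue (valRing K) x = 0 ↔ ‖(x : K)‖ < 1 := by
  rw [IsLocalRing.residue_eq_zero_iff, ValuationSubring.valuation_lt_one_iff]
  have := (Valuation.isEquiv_valuation_valuationSubring (NormedField.valuation (K := K))).lt_one_iff_lt_one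
    (x := (x : K))
  rw [← this, NormedField.valuation_apply, ← NNReal.coe_lt_coe, coe_nnnorm, NNReal.coe_one]

theorem map_subtype_ne_zero {Q : (valRing K)[X]}
    (hQ : Q.map (IsLocalRing.residue (valRing K)) ≠ 0) : Q.map (valRing K).subtype ≠ 0 := by
  rw [Ne, Polynomial.map_eq_zero_iff (Subtype.val_injective : Function.Injective (valRing K).subtype)]
  rintro rfl
  exact hQ (Polynomial.map_zero _)

theorem supNorm_map_le (P : (valRing K)[X]) : (P.map (valRing K).subtype).supNorm ≤ 1 := by
  obtain ⟨i, hi⟩ := (P.map (valRing K).subtype).exists_eq_supNorm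
  rw [hi, coeff_map]
  exact mem_valRing_iff.mp (P.coeff i).2

theorem map_residue_eq_zero_iff (P : (valRing K)[X]) :
    P.map (IsLocalRing.residue (valRing K)) = 0 ↔ (P.map (valRing K).subtype).supNorm < 1 := by
  constructor
  · intro h
    obtain ⟨i, hi⟩ := (P.map (valRing K).subtype).exists_eq_supNorm
    rw [hi, coeff_map]
    refine (residue_eq_zero_iff _).mp ?_
    rw [← coeff_map, h, coeff_zero]
  · intro h
    ext i
    rw [coeff_map, coeff_zero, residue_eq_zero_iff]
    refine lt_of_le_of_lt ?_ h
    have := (P.map (valRing K).subtype).le_supNorm i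
    rwa [coeff_map] at this

theorem Represents.supNorm_denom {f : RatFunc K} {P Q : (valRing K)[X]} (h : Represents f P Q) :
    (Q.map (valRing K).subtype).supNorm = 1 :=
  le_antisymm (supNorm_map_le Q) (not_lt.mp (mt (map_residue_eq_zero_iff Q).mpr h.1))

theorem Represents.ratGaussNorm_eq {f : RatFunc K} {P Q : (valRing K)[X]} (h : Represents f P Q) :
    ratGaussNorm f = (P.map (valRing K).subtype).supNorm := by
  rw [h.2, ratGaussNorm_div _ _ (map_subtype_ne_zero h.1), h.supNorm_denom, div_one]

/-- In a representing fraction the denominator has Gauss norm 1, so |f| is the norm of the integral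
numerator, which is below 1 exactly when that numerator reduces to 0. -/
theorem ratReduction_eq_zero_iff {f : RatFunc K} (hf : ratGaussNorm f ≤ 1) :
    ratReduction f = 0 ↔ ratGaussNorm f < 1 := by
  obtain ⟨P, Q, h⟩ := exists_represents hf
  rw [ratReduction_eq h, h.ratGaussNorm_eq, ← map_residue_eq_zero_iff, reducedFraction, div_eq_zero_iff,
    or_iff_left (RatFunc.algebraMap_ne_zero h.1),
    map_eq_zero_iff _ (RatFunc.algebraMap_injective _)]

theorem ratReduction_add {f g : RatFunc K} (hf : ratGaussNorm f ≤ 1) (hg : ratGaussNorm g ≤ 1) :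
    ratReduction (f + g) = ratReduction f + ratReduction g := by
  obtain ⟨P, Q, h⟩ := exists_represents hf
  obtain ⟨R, S, h'⟩ := exists_represents hg
  have : Represents (f + g) (P * S + Q * R) (Q * S) := by
    refine ⟨by rw [Polynomial.map_mul]; exact mul_ne_zero h.1 h'.1, ?_⟩
    rw [h.2, h'.2, div_add_div _ _ (RatFunc.algebraMap_ne_zero (map_subtype_ne_zero h.1))
      (RatFunc.algebraMap_ne_zero (map_subtype_ne_zero h'.1))]
    simp only [Polynomial.map_add, Polynomial.map_mul, map_add, map_mul]
  rw [ratReduction_eq this, ratReduction_eq h, ratReduction_eq h', reducedFraction, reducedFraction,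
    reducedFraction, div_add_div _ _ (RatFunc.algebraMap_ne_zero h.1)
      (RatFunc.algebraMap_ne_zero h'.1)]
  simp only [Polynomial.map_add, Polynomial.map_mul, map_add, map_mul]

theorem ratReduction_mul {f g : RatFunc K} (hf : ratGaussNorm f ≤ 1) (hg : ratGaussNorm g ≤ 1) :
    ratReduction (f * g) = ratReduction f * ratReduction g := by
  obtain ⟨P, Q, h⟩ := exists_represents hf
  obtain ⟨R, S, h'⟩ := exists_represents hg
  have : Represents (f * g) (P * R) (Q * S) := by
    refine ⟨by rw [Polynomial.map_mul]; exact mul_ne_zero h.1 h'.1, ?_⟩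
    rw [h.2, h'.2, div_mul_div_comm]
    simp only [Polynomial.map_mul, map_mul]
  rw [ratReduction_eq this, ratReduction_eq h, ratReduction_eq h', reducedFraction, reducedFraction,
    reducedFraction, div_mul_div_comm]
  simp only [Polynomial.map_mul, map_mul]

theorem ratReduction_ratDeriv {f : RatFunc K} (hf : ratGaussNorm f ≤ 1) :
    ratReduction (ratDeriv f) = ratDeriv (ratReduction f) := by
  obtain ⟨P, Q, h⟩ := exists_represents hf
  have : Represents (ratDeriv f) (derivative P * Q - P * derivative Q) (Q ^ 2) := by
    refine ⟨by rw [Polynomial.map_pow]; exact pow_ne_zero 2 h.1, ?_⟩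
    rw [h.2, ratDeriv_div _ _ (map_subtype_ne_zero h.1)]
    simp only [Polynomial.map_sub, Polynomial.map_mul, Polynomial.map_pow, derivative_map]
  rw [ratReduction_eq this, ratReduction_eq h, reducedFraction, reducedFraction,
    ratDeriv_div _ _ h.1]
  simp only [Polynomial.map_sub, Polynomial.map_mul, Polynomial.map_pow, derivative_map]

theorem ratReduction_zero : ratReduction (0 : RatFunc K) = 0 :=
  (ratReduction_eq_zero_iff (by simp [ratGaussNorm_zero])).mpr (by simp [ratGaussNorm_zero])

theorem ratGaussNorm_one : ratGaussNorm (1 : RatFunc K) = 1 := by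
  rw [← map_one (algebraMap K[X] (RatFunc K)), ratGaussNorm_algebraMap, ← C_1, supNorm_C, norm_one]

theorem ratReduction_one : ratReduction (1 : RatFunc K) = 1 := by
  have : Represents (1 : RatFunc K) 1 1 := ⟨by simp, by simp⟩
  rw [ratReduction_eq this]
  simp [reducedFraction]

theorem ratReduction_sum {ι : Type*} (s : Finset ι) (f : ι → RatFunc K)
    (h : ∀ i ∈ s, ratGaussNorm (f i) ≤ 1) :
    ratReduction (∑ i ∈ s, f i) = ∑ i ∈ s, ratReduction (f i) := by
  classical
  induction s using Finset.induction_on with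
  | empty => simp [ratReduction_zero]
  | insert a s ha ih =>
    have hs : ∀ i ∈ s, ratGaussNorm (f i) ≤ 1 := fun i hi => h i (Finset.mem_insert_of_mem hi)
    rw [Finset.sum_insert ha, Finset.sum_insert ha, ratReduction_add (h a (Finset.mem_insert_self a s))
      (ratGaussNorm_sum_le _ _ zero_le_one hs), ih hs]

theorem ratGaussNorm_ratDeriv_le (f : RatFunc K) : ratGaussNorm (ratDeriv f) ≤ ratGaussNorm f := by
  have := ratGaussNorm_iterate_le f 1
  rwa [Nat.factorial_one, Nat.cast_one, norm_one, one_mul] at this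

variable {n : ℕ}

theorem ratGaussNorm_matrix_mul_le {M N : Matrix (Fin n) (Fin n) (RatFunc K)} {a b : ℝ}
    (ha : 0 ≤ a) (hb : 0 ≤ b) (hM : ∀ i j, ratGaussNorm (M i j) ≤ a)
    (hN : ∀ i j, ratGaussNorm (N i j) ≤ b) (i j : Fin n) :
    ratGaussNorm ((M * N) i j) ≤ a * b := by
  rw [Matrix.mul_apply]
  refine ratGaussNorm_sum_le _ _ (mul_nonneg ha hb) fun k _ => ?_
  rw [ratGaussNorm_mul]
  exact mul_le_mul (hM i k) (hN k j) (ratGaussNorm_nonneg K _) ha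

theorem ratGaussNorm_conn_le {G M : Matrix (Fin n) (Fin n) (RatFunc K)} {a : ℝ} (ha : 0 ≤ a)
    (hG : ∀ i j, ratGaussNorm (G i j) ≤ 1) (hM : ∀ i j, ratGaussNorm (M i j) ≤ a) (i j : Fin n) :
    ratGaussNorm (conn G M i j) ≤ a := by
  rw [conn_apply, Matrix.add_apply, matDeriv_apply]
  refine (ratGaussNorm_add K _ _).trans (max_le ?_ ((ratGaussNorm_ratDeriv_le _).trans (hM i j)))
  simpa using ratGaussNorm_matrix_mul_le ha zero_le_one hM hG i j

theorem ratGaussNorm_iterate_conn_le {G M : Matrix (Fin n) (Fin n) (RatFunc K)} {a : ℝ}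
    (ha : 0 ≤ a) (hG : ∀ i j, ratGaussNorm (G i j) ≤ 1) (hM : ∀ i j, ratGaussNorm (M i j) ≤ a)
    (s : ℕ) : ∀ i j, ratGaussNorm ((conn G)^[s] M i j) ≤ a := by
  induction s with
  | zero => exact hM
  | succ s ih =>
    rw [Function.iterate_succ_apply']
    exact ratGaussNorm_conn_le ha hG ih

theorem ratGaussNorm_one_apply_le (i j : Fin n) :
    ratGaussNorm ((1 : Matrix (Fin n) (Fin n) (RatFunc K)) i j) ≤ 1 := by
  rw [Matrix.one_apply]
  split_ifs
  · exact ratGaussNorm_one.le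
  · simp [ratGaussNorm_zero]

theorem ratGaussNorm_iterMatrix_le {G : Matrix (Fin n) (Fin n) (RatFunc K)}
    (hG : ∀ i j, ratGaussNorm (G i j) ≤ 1) (s : ℕ) (i j : Fin n) :
    ratGaussNorm (iterMatrix G s i j) ≤ 1 := by
  rw [iterMatrix_eq_iterate]
  exact ratGaussNorm_iterate_conn_le zero_le_one hG ratGaussNorm_one_apply_le s i j

theorem matrixReduction_iterMatrix {G : Matrix (Fin n) (Fin n) (RatFunc K)}
    (hG : ∀ i j, ratGaussNorm (G i j) ≤ 1) (s : ℕ) :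
    matrixReduction (iterMatrix G s) = iterMatrix (matrixReduction G) s := by
  induction s with
  | zero =>
    ext i j
    simp only [iterMatrix, matrixReduction, Matrix.map_apply, Matrix.one_apply]
    split_ifs
    · exact ratReduction_one
    · exact ratReduction_zero
  | succ s ih =>
    have hs := ratGaussNorm_iterMatrix_le hG s
    ext i j
    rw [iterMatrix, iterMatrix, ← ih]
    simp only [matrixReduction, Matrix.map_apply, Matrix.add_apply]
    rw [ratReduction_add _ ((ratGaussNorm_ratDeriv_le _).trans (hs i j)),
      ratReduction_ratDeriv (hs i j), Matrix.mul_apply, Matrix.mul_apply, ratReduction_sum]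
    · simp only [Matrix.map_apply]
      congr 1
      exact Finset.sum_congr rfl fun k _ => ratReduction_mul (hs i k) (hG k j)
    · intro k _
      rw [ratGaussNorm_mul]
      exact mul_le_one₀ (hs i k) (ratGaussNorm_nonneg K _) (hG k j)
    · simpa using ratGaussNorm_matrix_mul_le zero_le_one zero_le_one hs hG i j

/-- The bridge between the two sides: vanishing in k(z) becomes a strict inequality over K. -/
theorem iterMatrix_matrixReduction_eq_zero_iff {G : Matrix (Fin n) (Fin n) (RatFunc K)}
    (hG : ∀ i j, ratGaussNorm (G i j) ≤ 1) (s : ℕ) :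
    iterMatrix (matrixReduction G) s = 0 ↔ ∀ i j, ratGaussNorm (iterMatrix G s i j) < 1 := by
  rw [← matrixReduction_iterMatrix hG, ← Matrix.ext_iff]
  refine forall₂_congr fun i j => ?_
  exact ratReduction_eq_zero_iff (ratGaussNorm_iterMatrix_le hG s i j)

/-- In the Leibniz sum the term without derivatives gains |G_N| ≤ θ, and every other term gains |p|
≤ θ from C(N,k)·k!. -/
theorem ratGaussNorm_iterate_conn_contract {G : Matrix (Fin n) (Fin n) (RatFunc K)} {N p : ℕ}
    (hpN : p ∣ N) {θ : ℝ} (hp : ‖(p : K)‖ ≤ θ)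
    (hG : ∀ i j, ratGaussNorm (G i j) ≤ 1) (hN : ∀ i j, ratGaussNorm (iterMatrix G N i j) ≤ θ)
    {M : Matrix (Fin n) (Fin n) (RatFunc K)} {a : ℝ} (ha : 0 ≤ a)
    (hM : ∀ i j, ratGaussNorm (M i j) ≤ a) (i j : Fin n) :
    ratGaussNorm ((conn G)^[N] M i j) ≤ θ * a := by
  have hθ : 0 ≤ θ := (norm_nonneg _).trans hp
  rw [iterate_conn, Matrix.sum_apply]
  refine ratGaussNorm_sum_le _ _ (mul_nonneg hθ ha) ?_
  rintro ⟨k, l⟩ hkl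
  rw [Finset.HasAntidiagonal.mem_antidiagonal] at hkl
  rw [Matrix.smul_apply, ratGaussNorm_nsmul]
  rcases Nat.eq_zero_or_pos k with rfl | hk
  · obtain rfl : l = N := by simpa using hkl
    simpa [mul_comm] using ratGaussNorm_matrix_mul_le ha hθ hM hN i j
  · have hD : ∀ i j, ratGaussNorm ((matDeriv K n)^[k] M i j) ≤ ‖(k ! : K)‖ * a := fun i j => by
      rw [iterate_matDeriv_apply]
      exact (ratGaussNorm_iterate_le _ _).trans (mul_le_mul_of_nonneg_left (hM i j) (norm_nonneg _))
    have h1 := ratGaussNorm_matrix_mul_le (mul_nonneg (norm_nonneg _) ha) zero_le_one hD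
      (ratGaussNorm_iterMatrix_le hG l) i j
    rw [mul_one] at h1
    refine (mul_le_mul_of_nonneg_left h1 (norm_nonneg _)).trans ?_
    rw [← mul_assoc]
    refine mul_le_mul_of_nonneg_right (le_trans ?_ hp) ha
    -- C(N,k)·k! = N(N-1)⋯(N-k+1) has N as a factor once k ≥ 1.
    have hdvd : p ∣ N.choose k * k ! := by
      rw [mul_comm, ← Nat.descFactorial_eq_factorial_mul_choose]
      obtain ⟨k, rfl⟩ := Nat.exists_eq_succ_of_ne_zero hk.ne'
      obtain ⟨N, rfl⟩ := Nat.exists_eq_succ_of_ne_zero (show N ≠ 0 by omega)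
      rw [Nat.succ_descFactorial_succ]
      exact hpN.mul_right _
    obtain ⟨c, hc⟩ := hdvd
    rw [← norm_mul, ← Nat.cast_mul, hc, Nat.cast_mul, norm_mul]
    exact mul_le_of_le_one_right (norm_nonneg _) (IsUltrametricDist.norm_natCast_le_one K _)

/-- Each full block of N iterations gains a factor θ; the remaining s mod N iterations do not
increase the norm, since |G| ≤ 1. -/
theorem ratGaussNorm_iterMatrix_le_pow {G : Matrix (Fin n) (Fin n) (RatFunc K)} {N p : ℕ}
    (hpN : p ∣ N) {θ : ℝ} (hp : ‖(p : K)‖ ≤ θ)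
    (hG : ∀ i j, ratGaussNorm (G i j) ≤ 1) (hN : ∀ i j, ratGaussNorm (iterMatrix G N i j) ≤ θ)
    (s : ℕ) (i j : Fin n) : ratGaussNorm (iterMatrix G s i j) ≤ θ ^ (s / N) := by
  have hθ : 0 ≤ θ := (norm_nonneg _).trans hp
  have key : ∀ m, ∀ i j, ratGaussNorm (iterMatrix G (N * m) i j) ≤ θ ^ m := by
    intro m
    induction m with
    | zero => simpa [iterMatrix] using ratGaussNorm_one_apply_le
    | succ m ih =>
      intro i j
      rw [mul_add_one, iterMatrix_add, pow_succ']
      exact ratGaussNorm_iterate_conn_contract hpN hp hG hN (pow_nonneg hθ m) ih i j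
  conv_lhs => rw [← Nat.div_add_mod s N, iterMatrix_add]
  exact ratGaussNorm_iterate_conn_le (pow_nonneg hθ _) hG (key _) _ i j

end Red

/-! ### Absolute values of factorials. -/

section Norms

variable {K : Type*} [NormedField K] [IsUltrametricDist K] (p : ℕ) [Fact p.Prime]
  [CharP (residueField K) p]

omit [Fact p.Prime] in
theorem norm_natCast_lt_one_iff (m : ℕ) : ‖(m : K)‖ < 1 ↔ p ∣ m := by
  rw [← CharP.cast_eq_zero_iff (residueField K) p, ← map_natCast (IsLocalRing.residue (valRing K)),
    residue_eq_zero_iff]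
  rfl

theorem norm_natCast_eq_pow {m : ℕ} (hm : m ≠ 0) : ‖(m : K)‖ = ‖(p : K)‖ ^ padicValNat p m := by
  obtain ⟨e, m', hndvd, rfl⟩ :=
    Nat.exists_eq_pow_mul_and_not_dvd hm p (Fact.out (p := p.Prime)).ne_one
  have h1 : ‖(m' : K)‖ = 1 := le_antisymm (IsUltrametricDist.norm_natCast_le_one K m')
    (not_lt.mp (mt (norm_natCast_lt_one_iff p m').mp hndvd))
  have h0 : m' ≠ 0 := by
    rintro rfl
    exact hndvd (dvd_zero p)
  rw [Nat.cast_mul, norm_mul, h1, mul_one, Nat.cast_pow, norm_pow,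
    padicValNat.mul (pow_ne_zero _ (Fact.out (p := p.Prime)).ne_zero) h0, padicValNat.prime_pow,
    padicValNat.eq_zero_of_not_dvd hndvd, add_zero]

/-- Legendre's formula: (p-1)·v_p(s!) is s minus the sum of the base-p digits of s. -/
theorem norm_factorial {c : ℝ} (hc : c ^ (p - 1) = ‖(p : K)‖) (s : ℕ) :
    ‖(s ! : K)‖ = c ^ (s - (p.digits s).sum) := by
  rw [norm_natCast_eq_pow p s.factorial_ne_zero, ← hc, ← pow_mul,
    sub_one_mul_padicValNat_factorial]

/-- The digit sum of p^k is 1, so at these indices the lower bound c^s for |s!| is sharp up to one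
factor c. -/
theorem norm_factorial_prime_pow {c : ℝ} (hc : c ^ (p - 1) = ‖(p : K)‖) (k : ℕ) :
    ‖((p ^ k)! : K)‖ = c ^ (p ^ k - 1) := by
  have hp := (Fact.out (p := p.Prime)).one_lt
  have := Nat.digits_base_pow_mul (k := k) hp one_pos
  rw [mul_one, Nat.digits_of_lt p 1 one_ne_zero hp] at this
  rw [norm_factorial p hc, this]
  simp

theorem pow_le_norm_factorial {c : ℝ} (hc0 : 0 ≤ c) (hc1 : c ≤ 1)
    (hc : c ^ (p - 1) = ‖(p : K)‖) (s : ℕ) : c ^ s ≤ ‖(s ! : K)‖ := by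
  rw [norm_factorial p hc]
  exact pow_le_pow_of_le_one hc0 hc1 (Nat.sub_le _ _)

end Norms

/-! ### The two implications between nilpotency and the radius. -/

section Radius

variable {K : Type*} [NormedField K] {Ω : Type*} [NontriviallyNormedField Ω] [NormedAlgebra K Ω]

theorem norm_ofScalars_genericSolution {t : Ω} (ht : IsGenericPoint K t) {n : ℕ}
    (G : Matrix (Fin n) (Fin n) (RatFunc K)) (i j : Fin n) (s : ℕ) :
    ‖FormalMultilinearSeries.ofScalars Ω
        (fun s => PowerSeries.coeff s (genericSolution G t i j)) s‖ =
      ratGaussNorm (iterMatrix G s i j) / ‖(s ! : K)‖ := by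
  rw [FormalMultilinearSeries.ofScalars_norm, genericSolution, Matrix.of_apply,
    PowerSeries.coeff_mk, norm_div, ht.2, ← norm_algebraMap' Ω (s ! : K), map_natCast]

variable [IsUltrametricDist K] (p : ℕ) [Fact p.Prime] [CharP (residueField K) p]
  {t : Ω} (ht : IsGenericPoint K t) {n : ℕ} {G : Matrix (Fin n) (Fin n) (RatFunc K)}
  (hG : ∀ i j, ratGaussNorm (G i j) ≤ 1) {π : Ω} (hπ0 : 0 < ‖π‖) (hπ : ‖π‖ ^ (p - 1) = ‖(p : K)‖)

include ht hG hπ0 hπ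

theorem isNilpotentSystem_of_lt_genericRadius (h : ‖π‖ₑ < genericRadius G t) :
    IsNilpotentSystem p (matrixReduction G) := by
  have hp := (Fact.out (p := p.Prime)).one_lt
  obtain ⟨r, hπr, hr⟩ := ENNReal.lt_iff_exists_nnreal_btwn.mp h
  have hπr' : ‖π‖ < r := by
    rw [← ofReal_norm, ENNReal.ofReal_lt_coe_iff (norm_nonneg π)] at hπr
    exact hπr
  have hr0 : (0 : ℝ) < r := hπ0.trans hπr'
  have key : ∀ i j, ∀ᶠ k in atTop, ratGaussNorm (iterMatrix G (p ^ k) i j) < 1 := by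
    intro i j
    obtain ⟨C, -, hC⟩ := FormalMultilinearSeries.norm_mul_pow_le_of_lt_radius _
      (hr.trans_le ((iInf_le _ i).trans (iInf_le _ j)))
    -- This sequence dominates |G_{p^k}|: from |G_s| r^s ≤ C|s!| with s = p^k and |s!| = |π|^(s-1).
    have hlim : Tendsto (fun k : ℕ => C / ‖π‖ * (‖π‖ / r) ^ p ^ k) atTop (𝓝 0) := by
      rw [← mul_zero (C / ‖π‖)]
      exact ((tendsto_pow_atTop_nhds_zero_of_lt_one (by positivity)
        ((div_lt_one hr0).mpr hπr')).comp (tendsto_pow_atTop_atTop_of_one_lt hp)).const_mul _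
    filter_upwards [hlim.eventually (gt_mem_nhds one_pos)] with k hk
    refine lt_of_le_of_lt ?_ hk
    have h1 := hC (p ^ k)
    rw [norm_ofScalars_genericSolution ht, norm_factorial_prime_pow p hπ] at h1
    have h2 : ‖π‖ ^ (p ^ k) = ‖π‖ ^ (p ^ k - 1) * ‖π‖ := by
      rw [← pow_succ, Nat.sub_add_cancel (Nat.pos_of_ne_zero (pow_ne_zero k (by omega)))]
    rw [div_mul_eq_mul_div, div_le_iff₀ (pow_pos hπ0 _)] at h1
    rw [div_pow, h2, div_mul_div_comm, le_div_iff₀ (by positivity)]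
    nlinarith
  -- One k serves all of the finitely many entries; k ≥ 1 makes p^k a multiple of p, so that the
  -- reduced G_{p^k} is a power of the reduced G_p.
  obtain ⟨k, hk, hk1⟩ := ((eventually_all.mpr fun i => eventually_all.mpr (key i)).and
    (eventually_ge_atTop 1)).exists
  refine ⟨p ^ (k - 1), ?_⟩
  rw [← iterMatrix_mul_char, ← pow_succ', Nat.sub_add_cancel hk1]
  exact (iterMatrix_matrixReduction_eq_zero_iff hG _).mpr hk

theorem lt_genericRadius_of_isNilpotentSystem (h : IsNilpotentSystem p (matrixReduction G)) :
    ‖π‖ₑ < genericRadius G t := by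
  have hp := Fact.out (p := p.Prime)
  have hp1 : ‖(p : K)‖ < 1 := (norm_natCast_lt_one_iff p p).mpr dvd_rfl
  have hp0 : 0 < ‖(p : K)‖ := hπ ▸ pow_pos hπ0 _
  have hπ1 : ‖π‖ ≤ 1 := by
    by_contra! hlt
    exact absurd (one_le_pow₀ hlt.le (n := p - 1)) (by rw [hπ]; exact not_le.mpr hp1)
  obtain ⟨m, hm⟩ := h
  -- The exponent m + 1 keeps N positive even if m = 0.
  set N := p * (m + 1) with hN
  have hN0 : N ≠ 0 := mul_ne_zero hp.ne_zero m.succ_ne_zero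
  have hGN : ∀ i j, ratGaussNorm (iterMatrix G N i j) < 1 := by
    rw [← iterMatrix_matrixReduction_eq_zero_iff hG, hN, iterMatrix_mul_char, pow_succ, hm, zero_mul]
  obtain ⟨θ, ⟨hpθ, hGθ⟩, hθ1⟩ : ∃ θ : ℝ, (‖(p : K)‖ ≤ θ ∧
      ∀ i j, ratGaussNorm (iterMatrix G N i j) ≤ θ) ∧ θ < 1 := by
    have hge : ∀ x : ℝ, x < 1 → ∀ᶠ θ in 𝓝[<] (1 : ℝ), x ≤ θ := fun x hx => by
      filter_upwards [Ioo_mem_nhdsLT hx] with θ hθ using hθ.1.le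
    exact (((hge _ hp1).and (eventually_all.mpr fun i => eventually_all.mpr fun j =>
      hge _ (hGN i j))).and self_mem_nhdsWithin).exists
  have hθ0 : 0 < θ := hp0.trans_le hpθ
  -- ρ = θ^(-1/N) is the gain in radius: N steps of growth ρ are paid for by one contraction θ.
  obtain ⟨ρ, hρ1, hρN⟩ : ∃ ρ : ℝ, 1 < ρ ∧ ρ ^ N = θ⁻¹ :=
    ⟨θ⁻¹ ^ (N⁻¹ : ℝ), Real.one_lt_rpow ((one_lt_inv₀ hθ0).mpr hθ1) (by positivity),
      Real.rpow_inv_natCast_pow (by positivity) hN0⟩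
  have hρ0 : 0 < ρ := one_pos.trans hρ1
  obtain ⟨r, hrρ⟩ : ∃ r : NNReal, (r : ℝ) = ‖π‖ * ρ :=
    ⟨(‖π‖ * ρ).toNNReal, Real.coe_toNNReal _ (by positivity)⟩
  have hr : ‖π‖ₑ < (r : ENNReal) := by
    rw [← ofReal_norm, ENNReal.ofReal_lt_coe_iff (norm_nonneg π)]
    change ‖π‖ < (r : ℝ)
    rw [hrρ]
    exact lt_mul_of_one_lt_right hπ0 hρ1
  refine hr.trans_le (le_iInf fun i => le_iInf fun j => ?_)
  -- After cancellation only ρ^(s mod N) remains, which ρ^N bounds uniformly in s.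
  refine FormalMultilinearSeries.le_radius_of_bound _ (ρ ^ N) fun s => ?_
  rw [norm_ofScalars_genericSolution ht, hrρ, mul_pow]
  have hfac := pow_le_norm_factorial p hπ0.le hπ1 hπ s
  have hG' := ratGaussNorm_iterMatrix_le_pow ⟨m + 1, hN⟩ hpθ hG hGθ s i j
  calc ratGaussNorm (iterMatrix G s i j) / ‖(s ! : K)‖ * (‖π‖ ^ s * ρ ^ s)
      ≤ θ ^ (s / N) / ‖π‖ ^ s * (‖π‖ ^ s * ρ ^ s) := by gcongr
    _ = θ ^ (s / N) * ρ ^ s := by field_simp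
    _ = θ ^ (s / N) * ((ρ ^ N) ^ (s / N) * ρ ^ (s % N)) := by
        rw [← pow_mul, ← pow_add, Nat.div_add_mod]
    _ = ρ ^ (s % N) := by
        rw [hρN, ← mul_assoc, ← mul_pow, mul_inv_cancel₀ hθ0.ne', one_pow, one_mul]
    _ ≤ ρ ^ N := pow_le_pow_right₀ hρ1.le (Nat.mod_lt s (Nat.pos_of_ne_zero hN0)).le

end Radius

end

end GenericRadius

/-! ### The criterion and the value of |π|. -/

theorem mainTheorem8 {K : Type*} [NormedField K] [IsUltrametricDist K] [CharZero K]
    (p : ℕ) [Fact p.Prime] [CharP (GenericRadius.residueField K) p]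
    {Ω : Type*} [NontriviallyNormedField Ω] [IsUltrametricDist Ω] [CompleteSpace Ω]
    [IsAlgClosed Ω] [NormedAlgebra K Ω]
    (t : Ω) (ht : GenericRadius.IsGenericPoint K t)
    (π : Ω) (hπ : π ^ (p - 1) = -(p : Ω))
    {n : ℕ} (G : Matrix (Fin n) (Fin n) (RatFunc K))
    (hG : GenericRadius.matrixGaussNorm G ≤ 1) :
    (GenericRadius.IsNilpotentSystem p (GenericRadius.matrixReduction G) ↔
      ‖π‖ₑ < GenericRadius.genericRadius G t) ∧
    ‖π‖ = ‖(p : K)‖ ^ (1 / ((p : ℝ) - 1)) ∧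
    (‖(p : K)‖ = (p : ℝ)⁻¹ → ‖π‖ = (p : ℝ) ^ (-(1 / ((p : ℝ) - 1)))) := by
  have hp := Fact.out (p := p.Prime)
  have hp1 : p - 1 ≠ 0 := Nat.sub_ne_zero_of_lt hp.one_lt
  have hnorm : ‖π‖ ^ (p - 1) = ‖(p : K)‖ := by
    rw [← norm_pow, hπ, norm_neg, ← norm_algebraMap' Ω (p : K), map_natCast]
  have hpK : 0 < ‖(p : K)‖ := norm_pos_iff.mpr (Nat.cast_ne_zero.mpr hp.ne_zero)
  have hπ0 : 0 < ‖π‖ := by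
    refine lt_of_le_of_ne (norm_nonneg π) fun h => hpK.ne ?_
    rw [← hnorm, ← h, zero_pow hp1]
  -- A real supremum dominates its terms only for a family bounded above, which holds here by
  -- finiteness.
  have hG' : ∀ i j, GenericRadius.ratGaussNorm (G i j) ≤ 1 := fun i j =>
    (le_ciSup (Set.finite_range fun ij : Fin n × Fin n =>
      GenericRadius.ratGaussNorm (G ij.1 ij.2)).bddAbove (i, j)).trans hG
  have hroot : ‖π‖ = ‖(p : K)‖ ^ (1 / ((p : ℝ) - 1)) := by
    rw [← hnorm, one_div, ← Nat.cast_pred hp.pos, Real.pow_rpow_inv_natCast hπ0.le hp1]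
  refine ⟨⟨GenericRadius.lt_genericRadius_of_isNilpotentSystem p ht hG' hπ0 hnorm,
    GenericRadius.isNilpotentSystem_of_lt_genericRadius p ht hG' hπ0 hnorm⟩, hroot, fun h => ?_⟩
  rw [hroot, h, Real.inv_rpow p.cast_nonneg, Real.rpow_neg p.cast_nonneg]
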